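/- For a finite field $\mathbb F_q$ fix an algebraic closure; all finite extensions of $\mathbb F_q$ are taken inside it. For linear codes of length $n$ (linear subspaces of $K^n$, with $K$ a finite extension of $\mathbb F_q$) let $k(\cdot)$ denote the dimension and $d(\cdot)$ the minimum Hamming distance (with $d(\{0\})=n+1$), let $*$ denote the coordinatewise product ($A*B$ is the linear span of all products $\mathbf a*\mathbf b$ with $\mathbf a\in A$, $\mathbf b\in B$), and let $\perp$ refer to the standard inner product $\sum_i a_ib_i$. A pair $(A,B)$ of $\mathbb F_{q^m}$-linear codes of length $n$ is a $t$-error correcting pair over $\mathbb F_{q^m}$ for an $\mathbb F_q$-linear code $C$ of length $n$ if $$(A*B)\perp C,\qquad k(A)>t,\qquad d(B^\perp)>t,\qquad d(A)+d(C)>n .$$ Let $t$ be an integer with $1\le t\le n/2-1$, and let $C$ be an $[n,n-2t,2t+1]$ code over $\mathbb F_q$ (length $n$, dimension $n-2t$, minimum distance $2t+1$) that has a $t$-error correcting pair $(A,B)$ over a finite extension of $\mathbb F_q$. Then for any $t$-error correcting pair $(A',B')$ for $C$ over a finite extension of $\mathbb F_q$ there are a common finite extension $K$ of the two fields over which $(A,B)$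 and $(A',B')$ are defined and a vector $\mathbf x\in K^n$ with all entries nonzero such that, after extending the scalars of all four codes to $K$, $$A'=\mathbf x*A\qquad\text{and}\qquad B'=\mathbf x^{-1}*B ,$$ where $\mathbf x^{-1}=(x_1^{-1},\dots,x_n^{-1})$ and $\mathbf x*A=\{\mathbf x*\mathbf a\mid \mathbf a\in A\}$. -/

import Mathlib

/-- The minimum distance of a linear code of length `n`: the least Hamming weight of a nonzero
codeword. Since weights are at most `n`, adjoining `n + 1` only matters for the zero code,
whose minimum distance is `n + 1` by convention. -/
noncomputable def minDist {K : Type*} [Field K] {n : ℕ} (C : Submodule K (Fin n → K)) : ℕ :=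
  open Classical in
  sInf (insert (n + 1) {w : ℕ | ∃ c ∈ C, c ≠ 0 ∧ hammingNorm c = w})

/-- The dual code `C^⊥` for the standard inner product `∑ i, x i * y i`. -/
def dualCode {K : Type*} [Field K] {n : ℕ} (C : Submodule K (Fin n → K)) :
    Submodule K (Fin n → K) where
  carrier := {y | ∀ c ∈ C, y ⬝ᵥ c = 0}
  add_mem' := by
    intro y z hy hz c hc
    rw [add_dotProduct, hy c hc, hz c hc, add_zero]
  zero_mem' := by
    intro c _
    exact zero_dotProduct c
  smul_mem' := by
    intro r y hy c hc
    rw [smul_dotProduct, hy c hc, smul_zero]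

/-- `A ⊥ B`: every codeword of `A` is orthogonal to every codeword of `B`. -/
def CodePerp {K : Type*} [Field K] {n : ℕ} (A B : Submodule K (Fin n → K)) : Prop :=
  ∀ a ∈ A, ∀ b ∈ B, a ⬝ᵥ b = 0

/-- Extension of scalars of a code along an embedding of fields `φ : k → K`: the `K`-linear code
generated by the (embedded) codewords of `C`. -/
def extendCode {k K : Type*} [Field k] [Field K] {n : ℕ} (φ : k →+* K)
    (C : Submodule k (Fin n → k)) : Submodule K (Fin n → K) :=
  Submodule.span K {y | ∃ c ∈ C, y = fun i => φ (c i)}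

/-- The code `x * A = {x * a | a ∈ A}` (coordinatewise multiplication by the vector `x`). -/
def scaleCode {K : Type*} [Field K] {n : ℕ} (x : Fin n → K) (A : Submodule K (Fin n → K)) :
    Submodule K (Fin n → K) :=
  A.map (LinearMap.mulLeft K x)

/-- `(A, B)` is a `t`-error correcting pair over the extension `E` of `F` for the `F`-linear
code `C`. Here `A * B` is the product of submodules of the `E`-algebra `Fin n → E`, which is the
`E`-span of the coordinatewise products `a * b` with `a ∈ A`, `b ∈ B`. -/
structure IsECP {F E : Type*} [Field F] [Field E] [Algebra F E] {n : ℕ} (t : ℕ)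
    (A B : Submodule E (Fin n → E)) (C : Submodule F (Fin n → F)) : Prop where
  perp : CodePerp (A * B) (extendCode (algebraMap F E) C)
  dim_gt : t < Module.finrank E A
  dual_dist_gt : t < minDist (dualCode B)
  dist_add_gt : n < minDist A + minDist C

/-! Since `C` is MDS, so is its dual `D` over any extension: a word of `D` with `2t` zeros is zero.
As `A * B` lies in `D`, counting zeros of products (`card_zeros_add_le`) forces `A` and `B` to be
MDS of dimensions `t + 1` and `t` (`IsECP.mdsOn`).

It remains to see that `D` factors in essentially one way. `exists_scalesInto` shows this for the
first factor by induction on `t`: shortening `A` at `i` and `B` at `j ≠ i` leaves a smaller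
factorization on the other coordinates, hence a local multiplier. Multipliers between MDS codes
longer than their dimension are unique up to a scalar (`ScalesInto.proportional`), so the local ones
glue, over varying `j` and then over two values of `i`. The second factor then follows, because a
nonzero word that multiplies `A` into `D` has fewer than `t` zeros. -/

open Finset

/-! ### MDS codes on a set of coordinates and their shortenings. -/

section MDS

variable {ι K : Type*} [Field K]

/-- On the coordinates in `S`, the code `V` behaves like an MDS code of dimension `r`: nonzero
codewords have fewer than `r` zeros in `S`, and some nonzero codeword vanishes on any prescribed
set of fewer than `r` coordinates. -/
structure MDSOn (V : Submodule K (ι → K)) (S : Finset ι) (r : ℕ) : Prop where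
  eq_zero : ∀ v ∈ V, ∀ Z ⊆ S, r ≤ #Z → (∀ k ∈ Z, v k = 0) → v = 0
  exists_vanishing : ∀ Z ⊆ S, #Z < r → ∃ v ∈ V, v ≠ 0 ∧ ∀ k ∈ Z, v k = 0

/-- Up to coordinates outside `S`, multiplication by `x` maps `V` into `V'`. -/
def ScalesInto (x : ι → K) (V V' : Submodule K (ι → K)) (S : Finset ι) : Prop :=
  ∀ v ∈ V, ∃ v' ∈ V', ∀ k ∈ S, v' k = x k * v k

/-- The subcode of the codewords that vanish at the coordinate `i`. -/
def vanishAt (V : Submodule K (ι → K)) (i : ι) : Submodule K (ι → K) :=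
  V ⊓ LinearMap.ker (LinearMap.proj i : (ι → K) →ₗ[K] K)

lemma mem_vanishAt {V : Submodule K (ι → K)} {i : ι} {v : ι → K} :
    v ∈ vanishAt V i ↔ v ∈ V ∧ v i = 0 := by
  simp [vanishAt]

lemma ScalesInto.of_eqOn_smul {V V' : Submodule K (ι → K)} {T : Finset ι} {x z : ι → K} (c : K)
    (hx : ScalesInto x V V' T) (hz : ∀ k ∈ T, z k = c * x k) : ScalesInto z V V' T := by
  intro v hv
  obtain ⟨v', hv', h⟩ := hx v hv
  refine ⟨c • v', V'.smul_mem _ hv', fun k hk => ?_⟩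
  simp [h k hk, hz k hk, mul_assoc]

variable [DecidableEq ι]

/-- The forced zero at `i` enlarges every zero set inside `T` by one, which lowers the dimension
parameter by one. -/
lemma MDSOn.vanishAt {V : Submodule K (ι → K)} {S T : Finset ι} {r : ℕ} {i : ι}
    (h : MDSOn V S (r + 1)) (hi : i ∈ S) (hT : T ⊆ S.erase i) : MDSOn (vanishAt V i) T r := by
  have key : ∀ Z ⊆ T, insert i Z ⊆ S ∧ #(insert i Z) = #Z + 1 := by
    intro Z hZ
    have h1 := hZ.trans hT
    exact ⟨insert_subset hi (h1.trans (erase_subset _ _)),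
      card_insert_of_notMem fun h2 => by simpa using h1 h2⟩
  refine ⟨fun v hv Z hZ hr hz => ?_, fun Z hZ hr => ?_⟩
  · obtain ⟨h1, h2⟩ := key Z hZ
    rw [mem_vanishAt] at hv
    exact h.eq_zero v hv.1 _ h1 (by omega) (by simpa [hv.2] using hz)
  · obtain ⟨h1, h2⟩ := key Z hZ
    obtain ⟨v, hv, hv0, hvz⟩ := h.exists_vanishing _ h1 (by omega)
    simp only [mem_insert, forall_eq_or_imp] at hvz
    exact ⟨v, mem_vanishAt.2 ⟨hv, hvz.1⟩, hv0, hvz.2⟩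

/-- A codeword vanishing exactly where prescribed. -/
lemma MDSOn.exists_eq_zero_ne_zero {V : Submodule K (ι → K)} {S Z : Finset ι} {r : ℕ}
    (h : MDSOn V S (r + 1)) (hZ : Z ⊆ S) (hr : #Z = r) :
    ∃ v ∈ V, (∀ k ∈ Z, v k = 0) ∧ ∀ k ∈ S, k ∉ Z → v k ≠ 0 := by
  obtain ⟨v, hv, hv0, hvz⟩ := h.exists_vanishing Z hZ (by omega)
  refine ⟨v, hv, hvz, fun k hk hkZ hvk => hv0 ?_⟩
  exact h.eq_zero v hv (insert k Z) (insert_subset hk hZ)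
    (by rw [card_insert_of_notMem hkZ, hr]) (by simpa [hvk] using hvz)

/-- The coordinates in any set of at most `r` positions can be separated by codewords. -/
lemma MDSOn.exists_separating {V : Submodule K (ι → K)} {S I : Finset ι} {r : ℕ}
    (h : MDSOn V S r) (hrS : r ≤ #S) (hI : I ⊆ S) (hIr : #I ≤ r) {k : ι} (hk : k ∈ I) :
    ∃ v ∈ V, v k ≠ 0 ∧ ∀ i ∈ I, i ≠ k → v i = 0 := by
  obtain ⟨J, hIJ, hJS, hJ⟩ := exists_subsuperset_card_eq hI hIr hrS
  have hkJ := hIJ hk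
  obtain ⟨r, rfl⟩ : ∃ s, r = s + 1 :=
    ⟨r - 1, by have := card_pos.2 ⟨k, hkJ⟩; omega⟩
  obtain ⟨v, hv, hvz, hvn⟩ := h.exists_eq_zero_ne_zero (Z := J.erase k)
    ((erase_subset _ _).trans hJS) (by rw [card_erase_of_mem hkJ, hJ]; rfl)
  exact ⟨v, hv, hvn k (hJS hkJ) (by simp), fun i hi hik => hvz i (by simp [hik, hIJ hi])⟩

/-- Codewords can be interpolated at `r` positions. -/
lemma MDSOn.exists_interpolating {V : Submodule K (ι → K)} {S Z : Finset ι} {r : ℕ}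
    (h : MDSOn V S r) (hZ : Z ⊆ S) (hr : #Z = r) (f : ι → K) :
    ∃ v ∈ V, ∀ k ∈ Z, v k = f k := by
  have hsep : ∀ k, ∃ v ∈ V, k ∈ Z → v k ≠ 0 ∧ ∀ i ∈ Z, i ≠ k → v i = 0 := by
    intro k
    by_cases hk : k ∈ Z
    · obtain ⟨v, hv, hv'⟩ := h.exists_separating (hr ▸ card_le_card hZ) hZ hr.le hk
      exact ⟨v, hv, fun _ => hv'⟩
    · exact ⟨0, V.zero_mem, fun h => absurd h hk⟩
  choose v hv hvZ using hsep
  refine ⟨∑ k ∈ Z, (f k / v k k) • v k, V.sum_mem fun k _ => V.smul_mem _ (hv k),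
    fun k hk => ?_⟩
  rw [Finset.sum_apply, sum_eq_single_of_mem k hk]
  · simp [div_mul_cancel₀ _ (hvZ k hk).1]
  · intro i hi hik
    simp [(hvZ i hi).2 k hk hik.symm]

/-! ### Uniqueness and gluing of multipliers. -/

/-- The multiplier between two MDS codes is unique up to a scalar. -/
lemma ScalesInto.proportional {V V' : Submodule K (ι → K)} {U : Finset ι} {r : ℕ} {x y : ι → K}
    (hV : MDSOn V U (r + 1)) (hV' : MDSOn V' U (r + 1)) (hU : r + 2 ≤ #U)
    (hx : ScalesInto x V V' U) (hy : ScalesInto y V V' U) {k l : ι} (hk : k ∈ U) (hl : l ∈ U) :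
    y k * x l = x k * y l := by
  rcases eq_or_ne k l with rfl | hkl
  · ring
  obtain ⟨Z, hZ, hZr⟩ := exists_subset_card_eq (s := (U.erase k).erase l) (n := r) (by
    rw [card_erase_of_mem (by simp [hl, hkl.symm]), card_erase_of_mem hk]; omega)
  have hZU : Z ⊆ U := hZ.trans ((erase_subset _ _).trans (erase_subset _ _))
  have hkZ : k ∉ Z := fun h => by simpa using hZ h
  have hlZ : l ∉ Z := fun h => by simpa using hZ h
  obtain ⟨v, hv, hvz, hvn⟩ := hV.exists_eq_zero_ne_zero hZU hZr
  obtain ⟨a, ha, hax⟩ := hx v hv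
  obtain ⟨b, hb, hby⟩ := hy v hv
  -- The combination vanishes on `Z` because `v` does, and at `k` by the choice of coefficients: `r
  -- + 1` zeros in all.
  have h0 : b k • a - a k • b = 0 := by
    refine hV'.eq_zero _ (V'.sub_mem (V'.smul_mem _ ha) (V'.smul_mem _ hb)) (insert k Z)
      (insert_subset hk hZU) (by rw [card_insert_of_notMem hkZ, hZr]) ?_
    intro i hi
    rcases mem_insert.1 hi with rfl | hi
    · simp [mul_comm]
    · simp [hax i (hZU hi), hby i (hZU hi), hvz i hi]
  have h1 := congrFun h0 l
  simp only [Pi.sub_apply, Pi.smul_apply, smul_eq_mul, Pi.zero_apply, hax k hk, hax l hl,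
    hby k hk, hby l hl] at h1
  have h2 : (v k * v l) * (y k * x l - x k * y l) = 0 := by linear_combination h1
  rcases mul_eq_zero.1 h2 with h3 | h3
  · exact absurd h3 (mul_ne_zero (hvn k hk hkZ) (hvn l hl hlZ))
  · exact sub_eq_zero.1 h3

/-- Multipliers that are proportional where both are defined have a common extension. -/
lemma exists_common_multiplier {V V' W W' : Submodule K (ι → K)} {T : Finset ι} {x y : ι → K}
    {i j : ι} (hx0 : ∀ k, x k ≠ 0) (hy0 : ∀ k, y k ≠ 0)
    (hT : ((T.erase i).erase j).Nonempty)
    (hx : ScalesInto x V V' (T.erase i)) (hy : ScalesInto y W W' (T.erase j))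
    (hxy : ∀ k ∈ (T.erase i).erase j, ∀ l ∈ (T.erase i).erase j, y k * x l = x k * y l) :
    ∃ z : ι → K, (∀ k, z k ≠ 0) ∧ ScalesInto z V V' (T.erase i) ∧
      ScalesInto z W W' (T.erase j) := by
  obtain ⟨m, hm⟩ := hT
  -- Normalize `y` to agree with `x` at `m`; it then agrees with `x` off `i` and `j`, and supplies
  -- the value at `i`, where `x` carries no information.
  refine ⟨fun k => if k = i then x m / y m * y i else x k, fun k => ?_,
    hx.of_eqOn_smul 1 fun k hk => ?_, hy.of_eqOn_smul (x m / y m) fun k hk => ?_⟩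
  · dsimp only
    split_ifs
    · exact mul_ne_zero (div_ne_zero (hx0 m) (hy0 m)) (hy0 i)
    · exact hx0 k
  · simp [(mem_erase.1 hk).1]
  · split_ifs with h
    · rw [h]
    · have h1 := hxy k (by simp_all) m hm
      have h2 := hy0 m
      field_simp
      linear_combination -h1

/-- The two images of a word agree off `i` and `j`, on at least `r` coordinates, so they are one
codeword. -/
lemma ScalesInto.of_erase {V V' : Submodule K (ι → K)} {T : Finset ι} {r : ℕ} {z : ι → K}
    {i j : ι} (hV' : MDSOn V' T r) (hT : r + 2 ≤ #T) (hij : i ≠ j)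
    (hi : ScalesInto z V V' (T.erase i)) (hj : ScalesInto z V V' (T.erase j)) :
    ScalesInto z V V' T := by
  intro v hv
  obtain ⟨a, ha, haz⟩ := hi v hv
  obtain ⟨b, hb, hbz⟩ := hj v hv
  have hab : a - b = 0 := by
    refine hV'.eq_zero _ (V'.sub_mem ha hb) ((T.erase i).erase j)
      ((erase_subset _ _).trans (erase_subset _ _)) ?_ fun k hk => ?_
    · have h1 := pred_card_le_card_erase (s := T) (a := i)
      have h2 := pred_card_le_card_erase (s := T.erase i) (a := j)
      omega
    · simp only [mem_erase] at hk
      simp [haz k (by simp [hk]), hbz k (by simp [hk])]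
  rw [sub_eq_zero] at hab
  subst hab
  refine ⟨a, ha, fun k hk => ?_⟩
  rcases eq_or_ne k i with rfl | hki
  · exact hbz k (by simp [hk, hij])
  · exact haz k (by simp [hk, hki])

/-! ### Uniqueness of the first factor, by induction on the dimension. -/

/-- Two factorizations of the same MDS code have first factors that differ by a multiplier. -/
theorem exists_scalesInto (t : ℕ) : ∀ (S : Finset ι) (A B A' B' D : Submodule K (ι → K)),
    2 * t + 4 ≤ #S → MDSOn A S (t + 2) → MDSOn B S (t + 1) → MDSOn A' S (t + 2) →
    MDSOn B' S (t + 1) →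
    (∀ d ∈ D, ∀ Z ⊆ S, 2 * t + 2 ≤ #Z → (∀ k ∈ Z, d k = 0) → ∀ k ∈ S, d k = 0) →
    (∀ a ∈ A, ∀ b ∈ B, a * b ∈ D) → (∀ a ∈ A', ∀ b ∈ B', a * b ∈ D) →
    ∃ x : ι → K, (∀ k, x k ≠ 0) ∧ ScalesInto x A A' S := by
  induction t with
  | zero =>
    intro S A B A' B' D hS hA hB hA' hB' hD hAB hAB'
    obtain ⟨b, hb, -, hb0⟩ := hB.exists_eq_zero_ne_zero (empty_subset S) card_empty
    obtain ⟨b', hb', -, hb0'⟩ := hB'.exists_eq_zero_ne_zero (empty_subset S) card_empty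
    obtain ⟨Z, hZ, hZ2⟩ := exists_subset_card_eq (s := S) (n := 2) (by omega)
    -- The words `b` and `b'` have no zeros in `S`, so their quotient is the multiplier; the value 1
    -- outside `S` only keeps it nonzero.
    refine ⟨fun k => if k ∈ S then b k / b' k else 1, fun k => ?_, fun a ha => ?_⟩
    · dsimp only
      split_ifs with hk
      · exact div_ne_zero (hb0 k hk (notMem_empty k)) (hb0' k hk (notMem_empty k))
      · exact one_ne_zero
    · obtain ⟨a', ha', haZ⟩ := hA'.exists_interpolating hZ hZ2 fun k => b k / b' k * a k
      have h0 := hD _ (D.sub_mem (hAB' a' ha' b' hb') (hAB a ha b hb)) Z hZ hZ2.ge fun k hk => by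
        have := hb0' k (hZ hk) (notMem_empty k)
        simp only [Pi.sub_apply, Pi.mul_apply, haZ k hk]
        field_simp
        ring
      refine ⟨a', ha', fun k hk => ?_⟩
      have h1 := h0 k hk
      have := hb0' k hk (notMem_empty k)
      simp only [Pi.sub_apply, Pi.mul_apply] at h1
      simp only [if_pos hk]
      field_simp
      linear_combination h1
  | succ t ih =>
    intro S A B A' B' D hS hA hB hA' hB' hD hAB hAB'
    -- Shortening the factors at different positions gives all products two forced zeros, so the
    -- bound for `D` drops by two, as the induction needs.
    have hpair : ∀ i ∈ S, ∀ j ∈ S, i ≠ j → ∃ x : ι → K, (∀ k, x k ≠ 0) ∧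
        ScalesInto x (vanishAt A i) (vanishAt A' i) ((S.erase i).erase j) := by
      intro i hi j hj hij
      have hcard : #((S.erase i).erase j) = #S - 2 := by
        rw [card_erase_of_mem (by simp [hj, hij.symm]), card_erase_of_mem hi]; omega
      have hTi : (S.erase i).erase j ⊆ S.erase i := erase_subset _ _
      have hTj : (S.erase i).erase j ⊆ S.erase j := by
        rw [erase_right_comm]; exact erase_subset _ _
      refine ih ((S.erase i).erase j) (vanishAt A i) (vanishAt B j) (vanishAt A' i)
        (vanishAt B' j) (vanishAt (vanishAt D i) j) (by omega) (hA.vanishAt hi hTi)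
        (hB.vanishAt hj hTj) (hA'.vanishAt hi hTi) (hB'.vanishAt hj hTj) ?_ ?_ ?_
      · intro d hd Z hZ hZt hdZ k hk
        simp only [mem_vanishAt] at hd
        have hjZ : j ∉ Z := fun h => by simpa using hZ h
        have hiZ : i ∉ insert j Z := fun h => by
          rcases mem_insert.1 h with h | h
          · exact hij h
          · simpa using hZ h
        refine hD d hd.1.1 (insert i (insert j Z)) (insert_subset hi (insert_subset hj
          (hZ.trans (hTi.trans (erase_subset _ _))))) ?_ (by simpa [hd] using hdZ) k
          (mem_of_mem_erase (mem_of_mem_erase hk))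
        rw [card_insert_of_notMem hiZ, card_insert_of_notMem hjZ]
        omega
      · intro a ha b hb
        simp only [mem_vanishAt] at *
        simp [hAB a ha.1 b hb.1, ha.2, hb.2]
      · intro a ha b hb
        simp only [mem_vanishAt] at *
        simp [hAB' a ha.1 b hb.1, ha.2, hb.2]
    have hsingle : ∀ i ∈ S, ∃ x : ι → K, (∀ k, x k ≠ 0) ∧
        ScalesInto x (vanishAt A i) (vanishAt A' i) (S.erase i) := by
      intro i hi
      have hTcard : #(S.erase i) = #S - 1 := card_erase_of_mem hi
      obtain ⟨j, hj, l, hl, hjl⟩ := one_lt_card.1 (show 1 < #(S.erase i) by omega)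
      obtain ⟨x, hx0, hx⟩ := hpair i hi j (mem_of_mem_erase hj) (ne_of_mem_erase hj).symm
      obtain ⟨y, hy0, hy⟩ := hpair i hi l (mem_of_mem_erase hl) (ne_of_mem_erase hl).symm
      have hUcard : #(((S.erase i).erase j).erase l) = #S - 3 := by
        rw [card_erase_of_mem (by simp_all [eq_comm]), card_erase_of_mem hj]; omega
      have hU : ((S.erase i).erase j).erase l ⊆ S.erase i :=
        (erase_subset _ _).trans (erase_subset _ _)
      have hUl : ((S.erase i).erase j).erase l ⊆ (S.erase i).erase l := by
        rw [erase_right_comm]; exact erase_subset _ _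
      obtain ⟨z, hz0, hzx, hzy⟩ := exists_common_multiplier hx0 hy0
        (card_pos.1 (by omega)) hx hy fun k hk m hm =>
          ScalesInto.proportional (hA.vanishAt hi hU) (hA'.vanishAt hi hU) (by omega)
            (fun v hv => (hx v hv).imp fun w hw => ⟨hw.1, fun k hk => hw.2 k (erase_subset _ _ hk)⟩)
            (fun v hv => (hy v hv).imp fun w hw => ⟨hw.1, fun k hk => hw.2 k (hUl hk)⟩) hk hm
      exact ⟨z, hz0, ScalesInto.of_erase (hA'.vanishAt hi subset_rfl) (by omega) hjl hzx hzy⟩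
    obtain ⟨i, hi, j, hj, hij⟩ := one_lt_card.1 (show 1 < #S by omega)
    obtain ⟨x, hx0, hx⟩ := hsingle i hi
    obtain ⟨y, hy0, hy⟩ := hsingle j hj
    have hUcard : #((S.erase i).erase j) = #S - 2 := by
      rw [card_erase_of_mem (by simp [hj, hij.symm]), card_erase_of_mem hi]; omega
    have hji : j ∈ S.erase i := mem_erase.2 ⟨hij.symm, hj⟩
    have hUj : (S.erase i).erase j ⊆ S.erase j := by
      rw [erase_right_comm]; exact erase_subset _ _
    have hAU := (hA.vanishAt hi subset_rfl).vanishAt hji subset_rfl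
    have hAU' := (hA'.vanishAt hi subset_rfl).vanishAt hji subset_rfl
    -- Both multipliers act on the words vanishing at `i` and `j`, and are compared there.
    obtain ⟨z, hz0, hzx, hzy⟩ := exists_common_multiplier hx0 hy0
      (card_pos.1 (by omega)) hx hy fun k hk m hm =>
        ScalesInto.proportional hAU hAU' (by omega) (fun v hv => by
          simp only [mem_vanishAt] at hv
          obtain ⟨w, hw, hwx⟩ := hx v (mem_vanishAt.2 hv.1)
          exact ⟨w, mem_vanishAt.2 ⟨hw, by simp [hwx j hji, hv.2]⟩,
            fun k hk => hwx k (erase_subset _ _ hk)⟩) (fun v hv => by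
          simp only [mem_vanishAt] at hv
          obtain ⟨w, hw, hwy⟩ := hy v (mem_vanishAt.2 ⟨hv.1.1, hv.2⟩)
          rw [mem_vanishAt] at hw
          exact ⟨w, mem_vanishAt.2 ⟨mem_vanishAt.2 ⟨hw.1,
            by simp [hwy i (mem_erase.2 ⟨hij, hi⟩), hv.1.2]⟩, hw.2⟩,
            fun k hk => hwy k (hUj hk)⟩) hk hm
    refine ⟨z, hz0, fun a ha => ?_⟩
    -- A multiple of `e` cancels the value of `a` at `j`, so `a` is a word vanishing at `i` plus one
    -- vanishing at `j`.
    obtain ⟨e, he, hej, hei⟩ := hA.exists_separating (I := {i, j}) (by omega)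
      (by simp [insert_subset_iff, hi, hj]) (card_le_two.trans (by omega)) (k := j) (by simp)
    have hei : e i = 0 := hei i (by simp) hij
    obtain ⟨p, hp, hpz⟩ := hzx e (mem_vanishAt.2 ⟨he, hei⟩)
    obtain ⟨q, hq, hqz⟩ := hzy (a - (a j / e j) • e) (mem_vanishAt.2
      ⟨A.sub_mem ha (A.smul_mem _ he), by simp [div_mul_cancel₀ _ hej]⟩)
    rw [mem_vanishAt] at hp hq
    have hp' : ∀ k ∈ S, p k = z k * e k := fun k hk => by
      rcases eq_or_ne k i with rfl | hki
      · simp [hp.2, hei]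
      · exact hpz k (mem_erase.2 ⟨hki, hk⟩)
    have hq' : ∀ k ∈ S, q k = z k * (a - (a j / e j) • e) k := fun k hk => by
      rcases eq_or_ne k j with rfl | hkj
      · simp [hq.2, div_mul_cancel₀ _ hej]
      · exact hqz k (mem_erase.2 ⟨hkj, hk⟩)
    refine ⟨(a j / e j) • p + q, A'.add_mem (A'.smul_mem _ hp.1) hq.1, fun k hk => ?_⟩
    simp only [Pi.add_apply, Pi.smul_apply, smul_eq_mul, hp' k hk, hq' k hk, Pi.sub_apply]
    ring

/-- If `w * V` lies in a code whose nonzero words have fewer than `m` zeros and any `p`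
coordinates are separated by `V`, then a nonzero `w` has at most `m - p` zeros. -/
lemma card_zeros_add_le [Fintype ι] {D V : Submodule K (ι → K)} {m p : ℕ}
    (hm : m + 1 ≤ Fintype.card ι) (hp : 1 ≤ p)
    (hD : ∀ d ∈ D, ∀ Z : Finset ι, m ≤ #Z → (∀ k ∈ Z, d k = 0) → d = 0)
    (hV : ∀ I : Finset ι, #I ≤ p → ∀ k ∈ I, ∃ v ∈ V, v k ≠ 0 ∧ ∀ i ∈ I, i ≠ k → v i = 0)
    {w : ι → K} (hw : ∀ v ∈ V, w * v ∈ D) (hw0 : w ≠ 0) {Z : Finset ι}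
    (hZ : ∀ k ∈ Z, w k = 0) : #Z + p ≤ m := by
  classical
  by_contra! hcon
  obtain ⟨k, hk⟩ := Function.ne_iff.1 hw0
  have hkW : k ∈ univ.filter fun i => w i ≠ 0 := by simpa using hk
  set W := univ.filter fun i => w i ≠ 0 with hWdef
  -- If the support has fewer than `p` elements, `I` is all of it and the product vanishes off `k`;
  -- `hm` makes that enough zeros.
  obtain ⟨I, hkI, hIW, hI⟩ := exists_subsuperset_card_eq (s := {k}) (t := W) (n := min p #W)
    (by simpa using hkW) (by
      have := card_pos.2 ⟨k, hkW⟩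
      rw [card_singleton]; omega) (min_le_right _ _)
  rw [singleton_subset_iff] at hkI
  obtain ⟨v, hv, hvk, hvI⟩ := hV I (by omega) k hkI
  have hne : w * v ≠ 0 := fun h => mul_ne_zero hk hvk (congrFun h k)
  refine hne (hD _ (hw v hv) (Wᶜ ∪ I.erase k) ?_ ?_)
  · have hZW : Z ⊆ Wᶜ := fun i hi => by simp [hWdef, hZ i hi]
    have hdisj : Disjoint Wᶜ (I.erase k) :=
      disjoint_left.2 fun i h1 h2 => (mem_compl.1 h1) (hIW (mem_of_mem_erase h2))
    have h1 := card_le_card hZW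
    have h2 := card_compl W
    have h3 := card_le_univ W
    rw [card_union_of_disjoint hdisj, card_erase_of_mem hkI, hI]
    have := card_pos.2 ⟨k, hkW⟩
    omega
  · intro i hi
    rcases mem_union.1 hi with h | h
    · have : w i = 0 := by simpa [hWdef] using h
      simp [this]
    · simp [hvI i (mem_of_mem_erase h) (ne_of_mem_erase h)]

end MDS

/-! ### Error correcting pairs as factorizations into MDS codes. -/

section Codes

variable {K : Type*} [Field K] {n : ℕ}

lemma minDist_le_hammingNorm {C : Submodule K (Fin n → K)} {c : Fin n → K} (hc : c ∈ C)
    (hc0 : c ≠ 0) {s : ℕ} {Z : Finset (Fin n)} (hZ : ∀ k ∉ Z, c k = 0) (hs : #Z ≤ s) :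
    minDist C ≤ s := by
  classical
  refine le_trans (Nat.sInf_le (Set.mem_insert_of_mem _ ⟨c, hc, hc0, rfl⟩)) (le_trans ?_ hs)
  unfold hammingNorm
  refine card_le_card fun k hk => ?_
  by_contra hkZ
  simp [hZ k hkZ] at hk

/-- A code separates any set of fewer coordinates than the minimum distance of its dual. -/
lemma exists_separating_of_lt_minDist_dualCode {B : Submodule K (Fin n → K)} {t : ℕ}
    (hB : t < minDist (dualCode B)) {I : Finset (Fin n)} (hI : #I ≤ t) {k : Fin n} (hk : k ∈ I) :
    ∃ b ∈ B, b k ≠ 0 ∧ ∀ i ∈ I, i ≠ k → b i = 0 := by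
  classical
  let π : (Fin n → K) →ₗ[K] (I → K) := LinearMap.funLeft K K Subtype.val
  have htop : B.map π = ⊤ := by
    -- Otherwise a nonzero functional kills the projection of `B`; extended by zero, it is a dual
    -- word of weight at most `t`.
    by_contra hne
    obtain ⟨f, hf0, hf⟩ := Submodule.exists_le_ker_of_lt_top _ (lt_top_iff_ne_top.2 hne)
    let y : Fin n → K := fun i => if h : i ∈ I then f (Pi.single ⟨i, h⟩ 1) else 0
    have hy : ∀ b, y ⬝ᵥ b = f (π b) := by
      intro b
      rw [LinearMap.pi_apply_eq_sum_univ f (π b), dotProduct,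
        ← Finset.sum_subset (subset_univ I) (by intro i _ hi; simp [y, hi]),
        ← Finset.sum_coe_sort I]
      refine Finset.sum_congr rfl fun i _ => ?_
      have : (fun j => if i = j then (1 : K) else 0) = Pi.single i 1 := by
        ext j; simp [Pi.single_apply, eq_comm]
      simp [y, π, LinearMap.funLeft_apply, mul_comm, this]
    have hyB : y ∈ dualCode B := fun b hb => by
      rw [hy]; exact hf (Submodule.mem_map_of_mem hb)
    have hy0 : y ≠ 0 := by
      rintro h0
      refine hf0 (LinearMap.pi_ext' fun i => LinearMap.ext_ring ?_)
      have := congrFun h0 i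
      simpa [y] using this
    have := minDist_le_hammingNorm hyB hy0 (Z := I) (fun i hi => by simp [y, hi]) hI
    omega
  obtain ⟨b, hb, hbk⟩ : Pi.single ⟨k, hk⟩ 1 ∈ B.map π := htop ▸ Submodule.mem_top
  have hval : ∀ i (hi : i ∈ I), b i = Pi.single (M := fun _ : I => K) ⟨k, hk⟩ 1 ⟨i, hi⟩ :=
    fun i hi => congrFun hbk ⟨i, hi⟩
  refine ⟨b, hb, by simp [hval k hk], fun i hi hik => ?_⟩
  rw [hval i hi, Pi.single_eq_of_ne (by simpa using hik)]

/-- Every set of `dim C` coordinates is an information set of an MDS code `C`. -/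
lemma exists_eq_single_of_mds {C : Submodule K (Fin n → K)} {s : ℕ}
    (hdim : Module.finrank K C = n - s) (hdist : s < minDist C) {J : Finset (Fin n)}
    (hJ : #J = n - s) (hs : s ≤ n) {k : Fin n} (hk : k ∈ J) :
    ∃ c ∈ C, c k = 1 ∧ ∀ i ∈ J, i ≠ k → c i = 0 := by
  classical
  let π : C →ₗ[K] (J → K) := (LinearMap.funLeft K K Subtype.val).comp C.subtype
  have hinj : Function.Injective π := by
    rw [← LinearMap.ker_eq_bot, LinearMap.ker_eq_bot']
    rintro ⟨c, hc⟩ hc0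
    by_contra hne
    have := minDist_le_hammingNorm hc (fun h => hne (Subtype.ext h)) (Z := Jᶜ) (s := s)
      (fun i hi => congrFun hc0 ⟨i, by simpa using hi⟩)
      (by rw [card_compl, hJ, Fintype.card_fin]; omega)
    omega
  have hsurj : Function.Surjective π :=
    (LinearMap.injective_iff_surjective_of_finrank_eq_finrank (by simp [hdim, hJ])).1 hinj
  obtain ⟨⟨c, hc⟩, hck⟩ := hsurj (Pi.single ⟨k, hk⟩ 1)
  have hval : ∀ i (hi : i ∈ J), c i = Pi.single (M := fun _ : J => K) ⟨k, hk⟩ 1 ⟨i, hi⟩ :=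
    fun i hi => congrFun hck ⟨i, hi⟩
  refine ⟨c, hc, by simp [hval k hk], fun i hi hik => ?_⟩
  rw [hval i hi, Pi.single_eq_of_ne (by simpa using hik)]

lemma mem_extendCode {k : Type*} [Field k] (φ : k →+* K) {C : Submodule k (Fin n → k)}
    {c : Fin n → k} (hc : c ∈ C) : (fun i => φ (c i)) ∈ extendCode φ C :=
  Submodule.subset_span ⟨c, hc, rfl⟩

/-- Words orthogonal to (the extension of) an MDS code have few zeros. -/
lemma eq_zero_of_mem_dualCode_extendCode {k : Type*} [Field k] (φ : k →+* K)
    {C : Submodule k (Fin n → k)} {s : ℕ} (hdim : Module.finrank k C = n - s)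
    (hdist : s < minDist C) (hs : s ≤ n) {d : Fin n → K} (hd : d ∈ dualCode (extendCode φ C))
    {Z : Finset (Fin n)} (hZs : s ≤ #Z) (hZ : ∀ i ∈ Z, d i = 0) : d = 0 := by
  obtain ⟨Y, hY, hYs⟩ := exists_subset_card_eq hZs
  ext i
  by_cases hi : i ∈ Y
  · exact hZ i (hY hi)
  -- Off `Y` this word is the unit vector at `i`, and `d` vanishes on `Y`, so the inner product is
  -- `d i`.
  obtain ⟨c, hc, hci, hcj⟩ := exists_eq_single_of_mds hdim hdist (J := Yᶜ)
    (by rw [card_compl, hYs, Fintype.card_fin]) hs (k := i) (by simpa using hi)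
  have h := hd _ (mem_extendCode φ hc)
  rw [dotProduct, Finset.sum_eq_single i] at h
  · simpa [hci] using h
  · intro j _ hji
    by_cases hj : j ∈ Y
    · simp [hZ j (hY hj)]
    · simp [hcj j (by simpa using hj) hji]
  · simp

lemma exists_vanishing_of_lt_finrank {A : Submodule K (Fin n → K)} {Z : Finset (Fin n)}
    (hZ : #Z < Module.finrank K A) : ∃ a ∈ A, a ≠ 0 ∧ ∀ i ∈ Z, a i = 0 := by
  let π : A →ₗ[K] (Z → K) := (LinearMap.funLeft K K Subtype.val).comp A.subtype
  obtain ⟨⟨a, ha⟩, haπ, ha0⟩ := Submodule.exists_mem_ne_zero_of_ne_bot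
    (LinearMap.ker_ne_bot_of_finrank_lt (f := π) (by simpa using hZ))
  exact ⟨a, ha, fun h => ha0 (Subtype.ext h), fun i hi => congrFun haπ ⟨i, hi⟩⟩

/-- Products of extended codewords stay orthogonal to the extended code. -/
lemma IsECP.mul_mem_dualCode {F E : Type*} [Field F] [Field E] [Algebra F E] [Algebra F K]
    {t : ℕ} {A B : Submodule E (Fin n → E)} {C : Submodule F (Fin n → F)} (h : IsECP t A B C)
    (φ : E →ₐ[F] K) {a b : Fin n → K} (ha : a ∈ extendCode (φ : E →+* K) A)
    (hb : b ∈ extendCode (φ : E →+* K) B) :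
    a * b ∈ dualCode (extendCode (algebraMap F K) C) := by
  intro c hc
  have hmul : a * b ∈ extendCode (φ : E →+* K) A * extendCode (φ : E →+* K) B :=
    Submodule.mul_mem_mul ha hb
  unfold extendCode at hmul hc
  rw [Submodule.span_mul_span] at hmul
  generalize a * b = p at hmul ⊢
  induction hc using Submodule.span_induction with
  | zero => simp
  | add x y _ _ hx hy => rw [dotProduct_add, hx, hy, add_zero]
  | smul r x _ hx => rw [dotProduct_smul, hx, smul_zero]
  | mem c hc =>
    obtain ⟨c, hc, rfl⟩ := hc
    induction hmul using Submodule.span_induction with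
    | zero => simp
    | add x y _ _ hx hy => rw [add_dotProduct, hx, hy, add_zero]
    | smul r x _ hx => rw [smul_dotProduct, hx, smul_zero]
    | mem d hd =>
      obtain ⟨_, ⟨a, ha, rfl⟩, _, ⟨b, hb, rfl⟩, rfl⟩ := hd
      have h0 := congrArg φ (h.perp _ (Submodule.mul_mem_mul ha hb) _
        (mem_extendCode (algebraMap F E) hc))
      simpa [dotProduct] using h0

/-- An error correcting pair for an MDS code consists, after any extension of scalars, of MDS
codes of dimensions `t + 1` and `t`. -/
lemma IsECP.mdsOn {F E : Type*} [Field F] [Field E] [Algebra F E] [Algebra F K]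
    {t : ℕ} {A B : Submodule E (Fin n → E)} {C : Submodule F (Fin n → F)} (h : IsECP t A B C)
    (ht : 1 ≤ t) (htn : 2 * t + 2 ≤ n) (hCdim : Module.finrank F C = n - 2 * t)
    (hCdist : minDist C = 2 * t + 1) (φ : E →ₐ[F] K) :
    MDSOn (extendCode (φ : E →+* K) A) univ (t + 1) ∧
      MDSOn (extendCode (φ : E →+* K) B) univ t := by
  have hD : ∀ d ∈ dualCode (extendCode (algebraMap F K) C), ∀ Z : Finset (Fin n), 2 * t ≤ #Z →
      (∀ k ∈ Z, d k = 0) → d = 0 := fun d hd Z hZ hdZ =>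
    eq_zero_of_mem_dualCode_extendCode (algebraMap F K) hCdim (by omega) (by omega) hd hZ hdZ
  have hBsep : ∀ I : Finset (Fin n), #I ≤ t → ∀ k ∈ I, ∃ b ∈ extendCode (φ : E →+* K) B,
      b k ≠ 0 ∧ ∀ i ∈ I, i ≠ k → b i = 0 := by
    intro I hI k hk
    obtain ⟨b, hb, hbk, hbI⟩ := exists_separating_of_lt_minDist_dualCode h.dual_dist_gt hI hk
    exact ⟨_, mem_extendCode (φ : E →+* K) hb, by simpa using hbk,
      fun i hi hik => by simp [hbI i hi hik]⟩
  have hn : Fintype.card (Fin n) = n := Fintype.card_fin n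
  -- Separation by `B` leaves words of `A` at most `2t - t` zeros; the resulting separation by `A`
  -- at `t + 1` places then leaves words of `B` at most `t - 1`.
  have hA : MDSOn (extendCode (φ : E →+* K) A) univ (t + 1) := by
    refine ⟨fun a ha Z _ hZ haZ => ?_, fun Z _ hZ => ?_⟩
    · by_contra ha0
      have := card_zeros_add_le (by omega) ht hD hBsep
        (fun b hb => h.mul_mem_dualCode φ ha hb) ha0 haZ
      omega
    · obtain ⟨a, ha, ha0, haZ⟩ := exists_vanishing_of_lt_finrank
        (lt_of_le_of_lt (Nat.lt_succ_iff.1 hZ) h.dim_gt)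
      refine ⟨_, mem_extendCode (φ : E →+* K) ha, fun h0 => ha0 ?_,
        fun i hi => by simp [haZ i hi]⟩
      ext i
      simpa using congrFun h0 i
  refine ⟨hA, fun b hb Z _ hZ hbZ => ?_, fun Z _ hZ => ?_⟩
  · by_contra hb0
    have := card_zeros_add_le (by omega) (by omega) hD (fun I hI k hk =>
      hA.exists_separating (by simp; omega) (subset_univ I) hI hk) (fun a ha => by
        rw [mul_comm]; exact h.mul_mem_dualCode φ ha hb) hb0 hbZ
    omega
  · obtain ⟨k, hk⟩ : ∃ k, k ∉ Z := by
      by_contra! hall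
      have := card_le_card (fun k _ => hall k : univ ⊆ Z)
      simp only [card_univ] at this
      omega
    obtain ⟨b, hb, hbk, hbZ⟩ := hBsep (insert k Z) (by rw [card_insert_of_notMem hk]; omega) k
      (mem_insert_self k Z)
    exact ⟨b, hb, fun h0 => hbk (congrFun h0 k), fun i hi =>
      hbZ i (mem_insert_of_mem hi) fun h => hk (h ▸ hi)⟩

/-! ### From the first factor to the whole pair. -/

/-- Error correcting pairs for the same MDS code differ by a multiplier over any common field of
definition. -/
theorem IsECP.exists_scaleCode_eq {F E E' : Type*} [Field F] [Field E] [Field E'] [Algebra F E]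
    [Algebra F E'] [Algebra F K] {t : ℕ} {C : Submodule F (Fin n → F)}
    {A B : Submodule E (Fin n → E)} {A' B' : Submodule E' (Fin n → E')}
    (h : IsECP t A B C) (h' : IsECP t A' B' C)
    (ht : 1 ≤ t) (htn : 2 * t + 2 ≤ n) (hCdim : Module.finrank F C = n - 2 * t)
    (hCdist : minDist C = 2 * t + 1) (φ : E →ₐ[F] K) (φ' : E' →ₐ[F] K) :
    ∃ x : Fin n → K, (∀ i, x i ≠ 0) ∧
      extendCode (φ' : E' →+* K) A' = scaleCode x (extendCode (φ : E →+* K) A) ∧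
      extendCode (φ' : E' →+* K) B' = scaleCode x⁻¹ (extendCode (φ : E →+* K) B) := by
  obtain ⟨hA, hB⟩ := h.mdsOn ht htn hCdim hCdist φ
  obtain ⟨hA', hB'⟩ := h'.mdsOn ht htn hCdim hCdist φ'
  have hD : ∀ d ∈ dualCode (extendCode (algebraMap F K) C), ∀ Z : Finset (Fin n), 2 * t ≤ #Z →
      (∀ k ∈ Z, d k = 0) → d = 0 := fun d hd Z hZ hdZ =>
    eq_zero_of_mem_dualCode_extendCode (algebraMap F K) hCdim (by omega) (by omega) hd hZ hdZ
  have hAB := fun a ha b hb => h.mul_mem_dualCode φ (a := a) (b := b) ha hb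
  have hAB' := fun a ha b hb => h'.mul_mem_dualCode φ' (a := a) (b := b) ha hb
  generalize extendCode (φ : E →+* K) A = V at *
  generalize extendCode (φ : E →+* K) B = W at *
  generalize extendCode (φ' : E' →+* K) A' = V' at *
  generalize extendCode (φ' : E' →+* K) B' = W' at *
  generalize dualCode (extendCode (algebraMap F K) C) = D at *
  obtain ⟨s, rfl⟩ : ∃ s, t = s + 1 := ⟨t - 1, by omega⟩
  obtain ⟨x, hx0, hx⟩ := exists_scalesInto s univ V W V' W' D
    (by simp only [card_univ, Fintype.card_fin]; omega) hA hB hA' hB'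
    (fun d hd Z _ hZ hdZ k _ => congrFun (hD d hd Z (by omega) hdZ) k) hAB hAB'
  have hxV : ∀ v ∈ V, x * v ∈ V' := by
    intro v hv
    obtain ⟨v', hv', hv''⟩ := hx v hv
    rwa [show x * v = v' from funext fun k => (hv'' k (mem_univ k)).symm]
  have hinterp : ∀ r ≤ n, ∃ Z : Finset (Fin n), #Z = r := fun r hr =>
    (exists_subset_card_eq (s := (univ : Finset (Fin n))) (by simpa using hr)).imp
      fun _ hZ => hZ.2
  have hWzero : ∀ w : Fin n → K, (∀ v ∈ V, w * v ∈ D) → ∀ Z : Finset (Fin n), s + 1 ≤ #Z →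
      (∀ k ∈ Z, w k = 0) → w = 0 := by
    intro w hw Z hZ hwZ
    by_contra hw0
    have := card_zeros_add_le (p := s + 2) (by rw [Fintype.card_fin]; omega) (by omega) hD
      (fun I hI k hk => hA.exists_separating (by simp; omega) (subset_univ I) hI hk) hw hw0 hwZ
    omega
  obtain ⟨Z, hZ⟩ := hinterp (s + 1) (by omega)
  -- The difference `x * w' - w` multiplies `V` into `D`, because `x * V` lies in `V'`; agreement on
  -- `Z` then makes it zero.
  have hxW : ∀ w ∈ W, ∀ w' ∈ W', (∀ k ∈ Z, x k * w' k = w k) → x * w' = w := by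
    intro w hw w' hw' hk
    refine sub_eq_zero.1 (hWzero _ (fun v hv => ?_) Z hZ.ge fun k hkZ => by simp [hk k hkZ])
    have : (x * w' - w) * v = (x * v) * w' - v * w := by ring
    rw [this]
    exact D.sub_mem (hAB' _ (hxV v hv) _ hw') (hAB _ hv _ hw)
  refine ⟨x, hx0, le_antisymm (fun v' hv' => ?_) ?_, le_antisymm (fun w' hw' => ?_) ?_⟩
  · obtain ⟨Y, hY⟩ := hinterp (s + 2) (by omega)
    obtain ⟨v, hv, hvY⟩ := hA.exists_interpolating (subset_univ Y) hY fun k => (x k)⁻¹ * v' k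
    refine ⟨v, hv, sub_eq_zero.1 (hA'.eq_zero _ (V'.sub_mem (hxV v hv) hv') Y (subset_univ Y)
      hY.ge fun k hk => ?_)⟩
    simp [hvY k hk, mul_inv_cancel_left₀ (hx0 k)]
  · rintro _ ⟨v, hv, rfl⟩
    exact hxV v hv
  · obtain ⟨w, hw, hwZ⟩ := hB.exists_interpolating (subset_univ Z) hZ (x * w')
    refine ⟨w, hw, ?_⟩
    rw [← hxW w hw w' hw' fun k hk => (hwZ k hk).symm]
    ext k
    simp [inv_mul_cancel_left₀ (hx0 k)]
  · rintro _ ⟨w, hw, rfl⟩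
    obtain ⟨w', hw', hwZ⟩ := hB'.exists_interpolating (subset_univ Z) hZ (x⁻¹ * w)
    have : LinearMap.mulLeft K x⁻¹ w = w' := by
      rw [← hxW w hw w' hw' fun k hk => by simp [hwZ k hk, mul_inv_cancel_left₀ (hx0 k)]]
      ext k
      simp [inv_mul_cancel_left₀ (hx0 k)]
    rwa [this]

end Codes

theorem corollary6p3 {F : Type*} [Field F] [Finite F] (n t : ℕ) (ht : 1 ≤ t)
    (htn : (t : ℚ) ≤ (n : ℚ) / 2 - 1)
    (C : Submodule F (Fin n → F))
    (hCdim : Module.finrank F C = n - 2 * t) (hCdist : minDist C = 2 * t + 1)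
    (E E' : IntermediateField F (AlgebraicClosure F))
    [FiniteDimensional F E] [FiniteDimensional F E']
    (A B : Submodule E (Fin n → E)) (hAB : IsECP t A B C)
    (A' B' : Submodule E' (Fin n → E')) (hAB' : IsECP t A' B' C) :
    ∃ (K : IntermediateField F (AlgebraicClosure F)) (_ : FiniteDimensional F K)
      (hE : E ≤ K) (hE' : E' ≤ K) (x : Fin n → K),
      (∀ i, x i ≠ 0) ∧
      extendCode (IntermediateField.inclusion hE').toRingHom A' =
        scaleCode x (extendCode (IntermediateField.inclusion hE).toRingHom A) ∧
      extendCode (IntermediateField.inclusion hE').toRingHom B' =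
        scaleCode x⁻¹ (extendCode (IntermediateField.inclusion hE).toRingHom B) := by
  have htn' : 2 * t + 2 ≤ n := by
    have : (2 * t + 2 : ℚ) ≤ n := by linarith
    exact_mod_cast this
  -- The multiplier exists over any common field of definition, so the compositum suffices.
  obtain ⟨x, hx⟩ := hAB.exists_scaleCode_eq hAB' ht htn' hCdim hCdist
    (IntermediateField.inclusion (le_sup_left : E ≤ E ⊔ E'))
    (IntermediateField.inclusion (le_sup_right : E' ≤ E ⊔ E'))
  exact ⟨E ⊔ E', IntermediateField.finiteDimensional_sup E E', le_sup_left, le_sup_right, x, hx⟩
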